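/- Let $\mathfrak g$ be a real step two nilpotent Lie algebra with inner product $\langle\cdot,\cdot\rangle$ and centre $\mathfrak z$, let $\mathfrak b=\mathfrak z^{\perp}$, and suppose that $\mathfrak g$ is of $H$-type: for every $Z\in\mathfrak z$ the map $J_Z:\mathfrak b\to\mathfrak b$ defined by $\langle J_ZX,Y\rangle=\langle Z,[X,Y]\rangle$ $(X,Y\in\mathfrak b)$ satisfies $J_Z^2=-|Z|^2I$. Let $B_1,\dots,B_{2n}$ and $Z_1,\dots,Z_m$ be orthonormal bases of $\mathfrak b$ and $\mathfrak z$, and let $U^{(k)}=(U^{(k)}_{j,l})$ be the real $2n\times 2n$ matrices with $[B_j,B_l]=\sum_{k=1}^m U^{(k)}_{j,l}Z_k$. Identify $(x_1,\dots,x_n,y_1,\dots,y_n)\in\mathbb R^{2n}$ with $z=x+iy\in\mathbb C^n$, so that each $U^{(k)}$ acts (real-linearly) on $\mathbb C^n$. For $\lambda\in\mathbb R^m\setminus\{0\}$ and $s>0$, the $\lambda$-twisted spherical mean of $f$ on the corresponding $H$-type group is $$f\times_\lambda\mu_s(z)=\int_{|w|=s}f(z-w)\,e^{\frac i2\sum_{k=1}^m\lambda_k\,\mathrm{Re}\,(z\cdot\overline{U^{(k)}w})}\,d\mu_s(w),$$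 where $\mu_s$ is the normalized surface measure on the sphere $\{w\in\mathbb C^n:|w|=s\}$. **Theorem.** Let $\lambda\in\mathbb R^m\setminus\{0\}$, and let $\partial\Omega$ be the boundary of a bounded domain (a non-empty connected bounded open set) $\Omega\subset\mathbb C^n$. Let $f:\mathbb C^n\to\mathbb C$ be such that $f(z)\,e^{(\frac14+\epsilon)|\lambda||z|^2}\in L^p(\mathbb C^n)$ for some $\epsilon>0$ and some $1\le p\le\infty$. Suppose that for every $z\in\partial\Omega$ one has $f\times_\lambda\mu_s(z)=0$ for almost every $s>0$ (in particular, if this holds for all $s>0$). Then $f=0$ almost everywhere. -/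

import Mathlib

open MeasureTheory

/-- The orthogonal complement `𝔟` of the centre `𝔷` of a real Lie algebra `𝔤` with respect to
the bilinear form `ip`, so that `𝔤 = 𝔟 ⊕ 𝔷` when `ip` is an inner product. -/
def horizontalSpace {𝔤 : Type*} [LieRing 𝔤] [LieAlgebra ℝ 𝔤] (ip : LinearMap.BilinForm ℝ 𝔤) :
    Submodule ℝ 𝔤 :=
  ip.orthogonal (LieAlgebra.center ℝ 𝔤).toSubmodule

/-- `𝔤` is a real step two nilpotent Lie algebra and `ip` is an inner product on it for which `𝔤`
is of `H`-type: for every central `Z`, the endomorphism `J_Z` of `𝔟` determined by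
`⟨J_Z X, Y⟩ = ⟨Z, [X, Y]⟩` for `X, Y ∈ 𝔟` satisfies `J_Z² = -|Z|² I`.
(`J_Z` is unique because `ip` is positive definite, and it is automatically skew-symmetric.) -/
structure IsHTypeLieAlgebra {𝔤 : Type*} [LieRing 𝔤] [LieAlgebra ℝ 𝔤]
    (ip : LinearMap.BilinForm ℝ 𝔤) : Prop where
  ip_symm : ∀ X Y : 𝔤, ip X Y = ip Y X
  ip_pos : ∀ X : 𝔤, X ≠ 0 → 0 < ip X X
  step_two : ∀ X Y W : 𝔤, ⁅X, ⁅Y, W⁆⁆ = 0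
  not_abelian : ∃ X Y : 𝔤, ⁅X, Y⁆ ≠ 0
  J_sq : ∀ Z ∈ LieAlgebra.center ℝ 𝔤,
    ∃ J : horizontalSpace ip →ₗ[ℝ] horizontalSpace ip,
      (∀ X Y : horizontalSpace ip, ip (J X : 𝔤) (Y : 𝔤) = ip Z ⁅(X : 𝔤), (Y : 𝔤)⁆) ∧
      ∀ X : horizontalSpace ip, J (J X) = -(ip Z Z) • X

/-- Orthonormal bases `B` (with `2n` elements) of `𝔟` and `C` (with `m` elements) of the centre
`𝔷`. The index type `Fin n ⊕ Fin n` records the coordinates `(x₁, …, xₙ, y₁, …, yₙ)` on `𝔟`. -/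
structure AdaptedFrame {𝔤 : Type*} [LieRing 𝔤] [LieAlgebra ℝ 𝔤]
    (ip : LinearMap.BilinForm ℝ 𝔤) (n m : ℕ) where
  B : Fin n ⊕ Fin n → 𝔤
  C : Fin m → 𝔤
  B_orthonormal : ∀ i j, ip (B i) (B j) = if i = j then 1 else 0
  C_orthonormal : ∀ i j, ip (C i) (C j) = if i = j then 1 else 0
  B_span : Submodule.span ℝ (Set.range B) = horizontalSpace ip
  C_span : Submodule.span ℝ (Set.range C) = (LieAlgebra.center ℝ 𝔤).toSubmodule

/-- The matrices `U⁽ᵏ⁾` of structure constants, `[B_j, B_l] = ∑ₖ U⁽ᵏ⁾_{j l} C_k`. -/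
def AdaptedFrame.structureMatrix {𝔤 : Type*} [LieRing 𝔤] [LieAlgebra ℝ 𝔤]
    {ip : LinearMap.BilinForm ℝ 𝔤} {n m : ℕ} (F : AdaptedFrame ip n m) (k : Fin m) :
    Matrix (Fin n ⊕ Fin n) (Fin n ⊕ Fin n) ℝ :=
  Matrix.of fun j l => ip ⁅F.B j, F.B l⁆ (F.C k)

/-- The real coordinates `(x₁, …, xₙ, y₁, …, yₙ)` of `z = x + iy ∈ ℂⁿ`. -/
def realCoords {n : ℕ} (z : EuclideanSpace ℂ (Fin n)) : Fin n ⊕ Fin n → ℝ :=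
  Sum.elim (fun j => (z j).re) (fun j => (z j).im)

/-- The complexification `x + iy ∈ ℂⁿ` of `(x₁, …, xₙ, y₁, …, yₙ)`. -/
noncomputable def complexification {n : ℕ} (x : Fin n ⊕ Fin n → ℝ) :
    EuclideanSpace ℂ (Fin n) :=
  WithLp.toLp 2 fun j => (x (Sum.inl j) : ℂ) + (x (Sum.inr j) : ℂ) * Complex.I

/-- `∑ₖ λₖ Re (z · conj (U⁽ᵏ⁾ w))`, where `U⁽ᵏ⁾ w` is the complexification of `U⁽ᵏ⁾ ξ` and `ξ` is
the vector of real coordinates of `w`. -/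
noncomputable def AdaptedFrame.phase {𝔤 : Type*} [LieRing 𝔤] [LieAlgebra ℝ 𝔤]
    {ip : LinearMap.BilinForm ℝ 𝔤} {n m : ℕ} (F : AdaptedFrame ip n m)
    (lam : EuclideanSpace ℝ (Fin m)) (z w : EuclideanSpace ℂ (Fin n)) : ℝ :=
  ∑ k, lam k *
    (∑ j, z j * (starRingEnd ℂ)
      (complexification ((F.structureMatrix k).mulVec (realCoords w)) j)).re

/-- The normalized surface measure `μ_s` on the sphere `{w ∈ ℂⁿ : |w| = s}` (`s > 0`). -/
noncomputable def normalizedSphereMeasure (n : ℕ) (s : ℝ) :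
    Measure (EuclideanSpace ℂ (Fin n)) :=
  ((volume : Measure (EuclideanSpace ℂ (Fin n))).toSphere Set.univ)⁻¹ •
    ((volume : Measure (EuclideanSpace ℂ (Fin n))).toSphere).map
      (fun ω : Metric.sphere (0 : EuclideanSpace ℂ (Fin n)) 1 => s • ω.1)

/-- The `λ`-twisted spherical mean
`f ×_λ μ_s (z) = ∫_{|w| = s} f (z - w) exp ((i/2) ∑ₖ λₖ Re (z · conj (U⁽ᵏ⁾ w))) dμ_s(w)`. -/
noncomputable def AdaptedFrame.twistedSphericalMean {𝔤 : Type*} [LieRing 𝔤] [LieAlgebra ℝ 𝔤]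
    {ip : LinearMap.BilinForm ℝ 𝔤} {n m : ℕ} (F : AdaptedFrame ip n m)
    (lam : EuclideanSpace ℝ (Fin m)) (f : EuclideanSpace ℂ (Fin n) → ℂ) (s : ℝ)
    (z : EuclideanSpace ℂ (Fin n)) : ℂ :=
  ∫ w, f (z - w) * Complex.exp (Complex.I / 2 * (F.phase lam z w : ℂ))
    ∂(normalizedSphereMeasure n s)

/-! Let A be the real-linear map of ℂⁿ with matrix ∑ λₖ U⁽ᵏ⁾ and L = |λ|. A is skew, and the H-type
condition gives A² = -L². Integrating the spherical means at z against e^{-cs²} s^{2n-1} ds shows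
that the twisted Gaussian mean U_c(z) = ∫ f(w) e^{-c|z-w|² + (i/2)⟨Az,w⟩} dw vanishes for z ∈ ∂Ω and
-L/4 ≤ c ≤ 0. Decay of f faster than e^{-L|z|²/4} is exactly what lets c go down to -L/4.

Now treat c as time. Let W_c be the integral U_c with the extra factor |z-w|², so that ∂_c|U|² =
-2⟨U,W⟩ (real inner product). At an interior spatial maximum of |U_c|², the second derivative tests
along an orthonormal basis add up to -8nc|U|² - 2P(c)⟨U,W⟩ ≤ 0 with P(c) = L²/4 - 4c². Hence
∂_c(Pⁿ|U|²) ≤ 0 there whenever P > 0. Since P(-L/4) = 0, the function Pⁿ|U|² has zero initial data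
as well as zero lateral data, and a parabolic maximum principle
(`twistedGaussian_eq_zero_of_frontier`) forces U_c = 0 in Ω for -L/4 < c ≤ 0.

At c = 0 the mean U_0 is a Fourier transform of f composed with the invertible map A/2. It is
analytic along lines and vanishes on the open set Ω, hence everywhere, so f = 0 almost everywhere.
-/

/-! ### Exponential families and derivative tests in one variable -/

open Filter Topology in
/-- Differentiation of the exponential family `s ↦ ∫ F e^{s ℓ}`. -/
theorem hasDerivAt_integral_mul_cexp {α : Type*} [MeasurableSpace α] {μ : Measure α}
    {F ℓ : α → ℂ} {R : ℝ} (hF : AEStronglyMeasurable F μ) (hℓ : AEStronglyMeasurable ℓ μ)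
    (hint : Integrable (fun w => ‖F w‖ * Real.exp (R * ‖ℓ w‖)) μ) {t : ℂ} (ht : ‖t‖ < R) :
    HasDerivAt (fun s : ℂ => ∫ w, F w * Complex.exp (s * ℓ w) ∂μ)
      (∫ w, F w * ℓ w * Complex.exp (t * ℓ w) ∂μ) t := by
  have hmeas : ∀ s : ℂ, AEStronglyMeasurable (fun w => F w * Complex.exp (s * ℓ w)) μ :=
    fun s => hF.mul (Complex.continuous_exp.comp_aestronglyMeasurable (hℓ.const_mul s))
  have hexp : ∀ (s : ℂ) (z : ℂ), ‖Complex.exp (s * z)‖ ≤ Real.exp (‖s‖ * ‖z‖) := fun s z => by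
    rw [Complex.norm_exp, ← norm_mul]
    exact Real.exp_le_exp.2 (Complex.re_le_norm _)
  -- Half of the margin R - ‖t‖ is the radius in s; the other half pays for the factor ‖ℓ‖ ≤ d⁻¹
  -- e^{d‖ℓ‖}.
  set d : ℝ := (R - ‖t‖) / 2 with hd
  have hd0 : 0 < d := by rw [hd]; linarith
  refine (hasDerivAt_integral_of_dominated_loc_of_deriv_le
    (F := fun s w => F w * Complex.exp (s * ℓ w))
    (F' := fun s w => F w * ℓ w * Complex.exp (s * ℓ w))
    (bound := fun w => d⁻¹ * (‖F w‖ * Real.exp (R * ‖ℓ w‖)))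
    (Metric.ball_mem_nhds t hd0) (.of_forall hmeas) ?_ ?_ ?_ (hint.const_mul _) ?_).2
  · refine hint.mono' (hmeas t) (.of_forall fun w => ?_)
    rw [norm_mul]
    gcongr
    exact (hexp _ _).trans (Real.exp_le_exp.2 (by gcongr))
  · exact (hF.mul hℓ).mul (Complex.continuous_exp.comp_aestronglyMeasurable (hℓ.const_mul t))
  · refine .of_forall fun w s hs => ?_
    have hs' : ‖s‖ ≤ R - d := by
      have h1 : ‖s - t‖ < d := by simpa [dist_eq_norm] using hs
      have h2 : ‖s‖ ≤ ‖t‖ + ‖s - t‖ := by simpa using norm_add_le t (s - t)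
      linarith
    have h3 : ‖ℓ w‖ ≤ d⁻¹ * Real.exp (d * ‖ℓ w‖) := by
      rw [inv_mul_eq_div, le_div_iff₀ hd0]
      linarith [Real.add_one_le_exp (d * ‖ℓ w‖)]
    rw [norm_mul, norm_mul]
    calc ‖F w‖ * ‖ℓ w‖ * ‖Complex.exp (s * ℓ w)‖
        ≤ ‖F w‖ * (d⁻¹ * Real.exp (d * ‖ℓ w‖)) * Real.exp ((R - d) * ‖ℓ w‖) := by
          gcongr
          exact (hexp _ _).trans (Real.exp_le_exp.2 (by gcongr))
      _ = d⁻¹ * (‖F w‖ * Real.exp (R * ‖ℓ w‖)) := by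
          have : Real.exp (R * ‖ℓ w‖) = Real.exp (d * ‖ℓ w‖) * Real.exp ((R - d) * ‖ℓ w‖) := by
            rw [← Real.exp_add]; ring_nf
          rw [this]; ring
  · refine .of_forall fun w s _ => ?_
    have := ((((hasDerivAt_id s).mul_const (ℓ w)).cexp).const_mul (F w))
    exact this.congr_deriv (by simp; ring)

open Filter Topology in
/-- The second derivative at a local maximum is nonpositive. -/
theorem IsLocalMax.second_deriv_nonpos {φ φ₁ : ℝ → ℝ} {x d : ℝ} (hmax : IsLocalMax φ x)
    (h₁ : ∀ᶠ t in 𝓝 x, HasDerivAt φ (φ₁ t) t) (h₂ : HasDerivAt φ₁ d x) : d ≤ 0 := by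
  by_contra! hd
  have he : deriv φ =ᶠ[𝓝 x] φ₁ := h₁.mono fun t ht => ht.deriv
  have hdd : deriv (deriv φ) x = d := by rw [he.deriv_eq, h₂.deriv]
  -- A positive second derivative makes x a local minimum too, so φ is locally constant and its
  -- second derivative is 0.
  have hmin : IsLocalMin φ x :=
    isLocalMin_of_deriv_deriv_pos (hdd ▸ hd) hmax.deriv_eq_zero h₁.self_of_nhds.continuousAt
  have hc : φ =ᶠ[𝓝 x] fun _ => φ x := by
    filter_upwards [hmax, hmin] with t h1 h2 using le_antisymm h1 h2
  have h0 : deriv (deriv φ) x = 0 := by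
    rw [hc.deriv.deriv_eq]; simp
  linarith

open Filter Topology in
/-- At a maximum from the left, the derivative is nonnegative. -/
theorem HasDerivAt.nonneg_of_forall_left_le {φ : ℝ → ℝ} {x d : ℝ} (h : HasDerivAt φ d x)
    (hmax : ∀ᶠ t in 𝓝[<] x, φ t ≤ φ x) : 0 ≤ d := by
  have hs := (hasDerivWithinAt_iff_tendsto_slope' (s := Set.Iio x) (by simp)).1
    h.hasDerivWithinAt
  refine ge_of_tendsto hs ?_
  filter_upwards [hmax, self_mem_nhdsWithin] with t ht htx
  rw [slope_def_field]
  exact div_nonneg_of_nonpos (by linarith) (by linarith [Set.mem_Iio.1 htx])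

open Filter Topology in
/-- The second order condition at a local maximum of `e^{-2ct²} |∫ F e^{tℓ}|²`. -/
theorem gaussian_mul_exponentialFamily_second_order {α : Type*} [MeasurableSpace α]
    {μ : Measure α} {F ℓ : α → ℂ} (c : ℝ) (hF : AEStronglyMeasurable F μ)
    (hℓ : AEStronglyMeasurable ℓ μ)
    (hint : Integrable (fun w => ‖F w‖ * Real.exp (2 * ‖ℓ w‖)) μ)
    (hmax : IsLocalMax (fun t : ℝ => Real.exp (-2 * c * t ^ 2) *
      ‖∫ w, F w * Complex.exp (t * ℓ w) ∂μ‖ ^ 2) 0) :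
    -4 * c * ‖∫ w, F w ∂μ‖ ^ 2 + 2 * inner ℝ (∫ w, F w ∂μ) (∫ w, F w * ℓ w ^ 2 ∂μ) ≤ 0 := by
  set M : ℝ → ℂ := fun t => ∫ w, F w * Complex.exp (t * ℓ w) ∂μ with hM
  set M₁ : ℝ → ℂ := fun t => ∫ w, F w * ℓ w * Complex.exp (t * ℓ w) ∂μ with hM₁
  have hint₁ : Integrable (fun w => ‖F w * ℓ w‖ * Real.exp (1 * ‖ℓ w‖)) μ := by
    refine hint.mono' ?_ (.of_forall fun w => ?_)
    · exact (hF.mul hℓ).norm.mul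
        (Real.continuous_exp.comp_aestronglyMeasurable (hℓ.norm.const_mul 1))
    · have h3 : ‖ℓ w‖ ≤ Real.exp ‖ℓ w‖ := by linarith [Real.add_one_le_exp ‖ℓ w‖]
      have h4 : Real.exp (2 * ‖ℓ w‖) = Real.exp ‖ℓ w‖ * Real.exp ‖ℓ w‖ := by
        rw [← Real.exp_add]; ring_nf
      rw [Real.norm_of_nonneg (by positivity), norm_mul, h4, one_mul, mul_assoc]
      gcongr
  have hd : ∀ t : ℝ, |t| < 2 → HasDerivAt M (M₁ t) t := fun t ht =>
    (hasDerivAt_integral_mul_cexp hF hℓ hint (t := (t : ℂ)) (by simpa using ht)).comp_ofReal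
  have hd₁ : HasDerivAt M₁ (∫ w, F w * ℓ w ^ 2 ∂μ) 0 := by
    have := (hasDerivAt_integral_mul_cexp (hF.mul hℓ) hℓ hint₁ (t := ((0 : ℝ) : ℂ))
      (by simp)).comp_ofReal
    refine this.congr_deriv ?_
    simp [pow_two, mul_assoc]
  have hg : ∀ t : ℝ, HasDerivAt (fun t : ℝ => Real.exp (-2 * c * t ^ 2))
      (Real.exp (-2 * c * t ^ 2) * (-4 * c * t)) t := fun t => by
    have := (((hasDerivAt_id t).pow 2).const_mul (-2 * c)).exp
    exact this.congr_deriv (by simp; ring)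
  have hφ : ∀ t : ℝ, |t| < 2 → HasDerivAt (fun t => Real.exp (-2 * c * t ^ 2) * ‖M t‖ ^ 2)
      (Real.exp (-2 * c * t ^ 2) * (-4 * c * t) * ‖M t‖ ^ 2 +
        Real.exp (-2 * c * t ^ 2) * (2 * inner ℝ (M t) (M₁ t))) t := fun t ht =>
    (hg t).mul (hd t ht).norm_sq
  have hM0 : M 0 = ∫ w, F w ∂μ := by simp [hM]
  have hx : HasDerivAt (fun t => Real.exp (-2 * c * t ^ 2) * (-4 * c * t) * ‖M t‖ ^ 2 +
        Real.exp (-2 * c * t ^ 2) * (2 * inner ℝ (M t) (M₁ t)))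
      (-4 * c * ‖M 0‖ ^ 2 + 2 * (inner ℝ (M 0) (∫ w, F w * ℓ w ^ 2 ∂μ) + ‖M₁ 0‖ ^ 2)) 0 := by
    have h0 := hd 0 (by simp)
    have := ((((hg 0).mul ((hasDerivAt_id (0 : ℝ)).const_mul (-4 * c))).mul h0.norm_sq)).add
      ((hg 0).mul ((h0.inner ℝ hd₁).const_mul 2))
    refine this.congr_deriv ?_
    simp
  have hnb : ∀ᶠ t : ℝ in 𝓝 0, |t| < 2 := by
    have : Metric.ball (0 : ℝ) 2 ∈ 𝓝 (0 : ℝ) := Metric.ball_mem_nhds _ (by norm_num)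
    filter_upwards [this] with t ht
    simpa using ht
  have := hmax.second_deriv_nonpos (hnb.mono hφ) hx
  rw [hM0] at this
  -- The first-order contribution 2‖M₁ 0‖² is nonnegative and is simply dropped.
  nlinarith [sq_nonneg ‖M₁ 0‖]

/-! ### Uniqueness of the Fourier transform -/

/-- An integrable function all of whose Fourier coefficients vanish is zero. -/
theorem MeasureTheory.Integrable.ae_eq_zero_of_integral_char_eq_zero {V : Type*}
    [NormedAddCommGroup V]
    [InnerProductSpace ℝ V] [FiniteDimensional ℝ V] [MeasurableSpace V] [BorelSpace V]
    {μ : Measure V} {f : V → ℂ} (hf : Integrable f μ)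
    (h : ∀ ξ : V, ∫ w, f w * Complex.exp ((inner ℝ w ξ : ℝ) * Complex.I) ∂μ = 0) :
    f =ᵐ[μ] 0 := by
  have hchar : ∀ ξ : V, Continuous fun w : V => Complex.exp ((inner ℝ w ξ : ℝ) * Complex.I) :=
    fun ξ => by fun_prop
  have hnorm : ∀ ξ w : V, ‖Complex.exp ((inner ℝ w ξ : ℝ) * Complex.I)‖ = 1 := fun ξ w =>
    Complex.norm_exp_ofReal_mul_I _
  -- For real g, the positive and negative parts are densities of two finite measures with equal
  -- characteristic functions.
  have hreal : ∀ g : V → ℝ, Integrable g μ →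
      (∀ ξ : V, ∫ w, (g w : ℂ) * Complex.exp ((inner ℝ w ξ : ℝ) * Complex.I) ∂μ = 0) →
      g =ᵐ[μ] 0 := by
    intro g hg hz
    have hgp := hg.pos_part
    have hgn := hg.neg_part
    have hfin : ∀ u : V → ℝ, Integrable u μ →
        IsFiniteMeasure (μ.withDensity fun w => ENNReal.ofReal (u w)) := fun u hu =>
      isFiniteMeasure_withDensity_ofReal hu.2
    have := hfin _ hgp
    have := hfin _ hgn
    have hcf : ∀ u : V → ℝ, Integrable u μ → (∀ w, 0 ≤ u w) → ∀ ξ : V,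
        charFun (μ.withDensity fun w => ENNReal.ofReal (u w)) ξ
          = ∫ w, (u w : ℂ) * Complex.exp ((inner ℝ w ξ : ℝ) * Complex.I) ∂μ := by
      intro u hu hu0 ξ
      rw [charFun_apply, integral_withDensity_eq_integral_toReal_smul₀
        hu.aestronglyMeasurable.aemeasurable.ennreal_ofReal (by simp)]
      refine integral_congr_ae (.of_forall fun w => ?_)
      simp [ENNReal.toReal_ofReal (hu0 w)]
    have hI : ∀ u : V → ℝ, Integrable u μ → ∀ ξ : V,
        Integrable (fun w => (u w : ℂ) * Complex.exp ((inner ℝ w ξ : ℝ) * Complex.I)) μ :=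
      fun u hu ξ => hu.ofReal.mul_bdd (c := 1) (hchar ξ).aestronglyMeasurable
        (.of_forall fun w => (hnorm ξ w).le)
    have heq : (μ.withDensity fun w => ENNReal.ofReal (max (g w) 0))
        = μ.withDensity fun w => ENNReal.ofReal (max (-g w) 0) := by
      refine Measure.ext_of_charFun (funext fun ξ => ?_)
      rw [hcf _ hgp (fun w => le_max_right _ _), hcf _ hgn (fun w => le_max_right _ _),
        ← sub_eq_zero, ← integral_sub (hI _ hgp ξ) (hI _ hgn ξ), ← hz ξ]
      refine integral_congr_ae (.of_forall fun w => ?_)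
      have : g w = max (g w) 0 - max (-g w) 0 := by simp
      simp only []
      rw [← sub_mul, ← Complex.ofReal_sub, ← this]
    have hae := (withDensity_eq_iff hgp.aestronglyMeasurable.aemeasurable.ennreal_ofReal
      hgn.aestronglyMeasurable.aemeasurable.ennreal_ofReal
      (hgp.lintegral_lt_top).ne).1 heq
    filter_upwards [hae] with w hw
    rw [ENNReal.ofReal_eq_ofReal_iff (le_max_right _ _) (le_max_right _ _)] at hw
    rcases le_total (g w) 0 with h0 | h0
    · rw [max_eq_right h0, max_eq_left (by linarith)] at hw
      simp; linarith
    · rw [max_eq_left h0, max_eq_right (by linarith)] at hw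
      simpa using hw
  have hfI : ∀ ξ : V,
      Integrable (fun w => f w * Complex.exp ((inner ℝ w ξ : ℝ) * Complex.I)) μ :=
    fun ξ => hf.mul_bdd (c := 1) (hchar ξ).aestronglyMeasurable
      (.of_forall fun w => (hnorm ξ w).le)
  have hconj : ∀ ξ : V, ∫ w, (starRingEnd ℂ) (f w) *
      Complex.exp ((inner ℝ w ξ : ℝ) * Complex.I) ∂μ = 0 := fun ξ => by
    have := congrArg (starRingEnd ℂ) (h (-ξ))
    rw [← integral_conj, map_zero] at this
    rw [← this]
    refine integral_congr_ae (.of_forall fun w => ?_)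
    simp [← Complex.exp_conj]
  have hfcI : ∀ ξ : V, Integrable (fun w => (starRingEnd ℂ) (f w) *
      Complex.exp ((inner ℝ w ξ : ℝ) * Complex.I)) μ :=
    fun ξ => Integrable.mul_bdd (c := 1) (Complex.conjLIE.integrable_comp_iff.2 hf)
      (hchar ξ).aestronglyMeasurable
      (.of_forall fun w => (hnorm ξ w).le)
  have hre := hreal (fun w => (f w).re) hf.re fun ξ => by
    have : ∀ w, ((f w).re : ℂ) * Complex.exp ((inner ℝ w ξ : ℝ) * Complex.I)
        = (1 / 2 : ℂ) * (f w * Complex.exp ((inner ℝ w ξ : ℝ) * Complex.I) +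
          (starRingEnd ℂ) (f w) * Complex.exp ((inner ℝ w ξ : ℝ) * Complex.I)) := fun w => by
      rw [← add_mul, Complex.add_conj]; push_cast; ring
    simp_rw [this]
    rw [integral_const_mul, integral_add (hfI ξ) (hfcI ξ), h, hconj]; simp
  have him := hreal (fun w => (f w).im) hf.im fun ξ => by
    have : ∀ w, ((f w).im : ℂ) * Complex.exp ((inner ℝ w ξ : ℝ) * Complex.I)
        = (-Complex.I / 2 : ℂ) * (f w * Complex.exp ((inner ℝ w ξ : ℝ) * Complex.I) -
          (starRingEnd ℂ) (f w) * Complex.exp ((inner ℝ w ξ : ℝ) * Complex.I)) := fun w => by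
      rw [← sub_mul, Complex.sub_conj]; push_cast; 
      linear_combination (((f w).im : ℂ) * Complex.exp ((inner ℝ w ξ : ℝ) * Complex.I)) * Complex.I_sq
    simp_rw [this]
    rw [integral_const_mul, integral_sub (hfI ξ) (hfcI ξ), h, hconj]; simp
  filter_upwards [hre, him] with w h1 h2
  exact Complex.ext h1 h2

/-! ### Twisted Gaussian means: integrability and restriction to lines -/

/-- The twisted convolution of `f` with the Gaussian `e^{-c|w|²}`. -/
noncomputable def twistedGaussian {V : Type*} [NormedAddCommGroup V] [InnerProductSpace ℝ V]
    [MeasurableSpace V] (μ : Measure V) (A : V →ₗ[ℝ] V) (f : V → ℂ) (c : ℝ) (x : V) : ℂ :=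
  ∫ w, f w * Complex.exp (-(c * ‖x - w‖ ^ 2 : ℝ) + (inner ℝ (A x) w / 2 : ℝ) * Complex.I) ∂μ

theorem integrable_norm_mul_exp_of_quadratic_bound {V : Type*} [NormedAddCommGroup V]
    [MeasurableSpace V] [BorelSpace V] {μ : Measure V} {f : V → ℂ} {a b C r : ℝ}
    (hf : AEStronglyMeasurable f μ)
    (hint : Integrable (fun w => ‖f w‖ * Real.exp (a * ‖w‖ ^ 2)) μ) (hb : b < a)
    {g : V → ℝ} (hg : Continuous g)
    (hgb : ∀ w, g w ≤ b * (r + ‖w‖) ^ 2 + C * (r + ‖w‖)) :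
    Integrable (fun w => ‖f w‖ * Real.exp (g w)) μ := by
  -- D is the coefficient of ‖w‖ in the expanded bound; completing the square absorbs D‖w‖ into (a -
  -- b)‖w‖² and a constant.
  set D := 2 * b * r + C with hD
  set C' := D ^ 2 / (4 * (a - b)) + b * r ^ 2 + C * r with hC'
  refine (hint.mul_const (Real.exp C')).mono' ?_ (.of_forall fun w => ?_)
  · exact hf.norm.mul (Real.continuous_exp.comp hg).aestronglyMeasurable
  · rw [Real.norm_of_nonneg (by positivity), mul_assoc, ← Real.exp_add]
    gcongr
    refine (hgb w).trans ?_
    have hab : 0 < a - b := by linarith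
    have key : D * ‖w‖ ≤ (a - b) * ‖w‖ ^ 2 + D ^ 2 / (4 * (a - b)) := by
      have : 0 ≤ (a - b) * (‖w‖ - D / (2 * (a - b))) ^ 2 := by positivity
      have h2 : (a - b) * (‖w‖ - D / (2 * (a - b))) ^ 2
          = (a - b) * ‖w‖ ^ 2 - D * ‖w‖ + D ^ 2 / (4 * (a - b)) := by
        field_simp; ring
      linarith
    rw [hC']
    nlinarith [key, hD]

theorem neg_mul_norm_sub_sq_le {V : Type*} [SeminormedAddCommGroup V] {L c r : ℝ} (hc : -(L / 4) ≤ c) (hL : 0 ≤ L)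
    {x w : V} (hx : ‖x‖ ≤ r) : -(c * ‖x - w‖ ^ 2) ≤ L / 4 * (r + ‖w‖) ^ 2 := by
  have h1 : ‖x - w‖ ≤ r + ‖w‖ := (norm_sub_le _ _).trans (by linarith)
  calc -(c * ‖x - w‖ ^ 2) = (-c) * ‖x - w‖ ^ 2 := by ring
    _ ≤ L / 4 * ‖x - w‖ ^ 2 := by gcongr; linarith
    _ ≤ _ := by gcongr

theorem norm_twistedGaussian_kernel {V : Type*} [NormedAddCommGroup V] [InnerProductSpace ℝ V]
    {A : V →ₗ[ℝ] V} (c : ℝ) (x w : V) (z : ℂ) :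
    ‖z * Complex.exp (-(c * ‖x - w‖ ^ 2 : ℝ) + (inner ℝ (A x) w / 2 : ℝ) * Complex.I)‖
      = ‖z‖ * Real.exp (-(c * ‖x - w‖ ^ 2)) := by
  rw [norm_mul, Complex.norm_exp]
  simp [-Complex.ofReal_pow]

section TwistedGaussian

variable {V : Type*} [NormedAddCommGroup V] [InnerProductSpace ℝ V] [MeasurableSpace V]
  {μ : Measure V} {A : V →ₗ[ℝ] V} {f : V → ℂ} {a L : ℝ}

theorem twistedGaussian_zero_eq (x : V) : twistedGaussian μ A f 0 x =
    ∫ w, f w * Complex.exp ((inner ℝ (A x) w / 2 : ℝ) * Complex.I) ∂μ := by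
  simp [twistedGaussian]

/-- The restriction of a twisted Gaussian mean to a line. -/
theorem norm_sq_twistedGaussian_add_smul (c : ℝ) (x e : V) (he : ‖e‖ = 1) (t : ℝ) :
    ‖twistedGaussian μ A f c (x + t • e)‖ ^ 2 = Real.exp (-2 * c * t ^ 2) *
      ‖∫ w, f w *
          Complex.exp (-(c * ‖x - w‖ ^ 2 : ℝ) + (inner ℝ (A x) w / 2 : ℝ) * Complex.I) *
        Complex.exp (t * (((-2 * c * inner ℝ (x - w) e : ℝ) : ℂ) -
          ((inner ℝ (A e) (x - w) / 2 : ℝ) : ℂ) * Complex.I)) ∂μ‖ ^ 2 := by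
  -- Writing ⟨Ae,w⟩ = ⟨Ae,x⟩ - ⟨Ae,x-w⟩ pulls a phase out of the integral and leaves an exponent
  -- that depends on x - w alone.
  have key : twistedGaussian μ A f c (x + t • e) =
      Complex.exp ((-(c * t ^ 2) : ℝ) + (t * inner ℝ (A e) x / 2 : ℝ) * Complex.I) *
      ∫ w, f w *
          Complex.exp (-(c * ‖x - w‖ ^ 2 : ℝ) + (inner ℝ (A x) w / 2 : ℝ) * Complex.I) *
        Complex.exp (t * (((-2 * c * inner ℝ (x - w) e : ℝ) : ℂ) -
          ((inner ℝ (A e) (x - w) / 2 : ℝ) : ℂ) * Complex.I)) ∂μ := by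
    rw [twistedGaussian, ← integral_const_mul]
    refine integral_congr_ae (.of_forall fun w => ?_)
    simp only []
    rw [mul_assoc, mul_left_comm, ← Complex.exp_add, ← Complex.exp_add]
    congr 2
    have h1 : ‖x + t • e - w‖ ^ 2 = ‖x - w‖ ^ 2 + 2 * t * inner ℝ (x - w) e + t ^ 2 := by
      rw [add_sub_right_comm, norm_add_sq_real, inner_smul_right, norm_smul, he]
      simp; ring
    have h2 : inner ℝ (A (x + t • e)) w = inner ℝ (A x) w + t * inner ℝ (A e) w := by
      rw [map_add, map_smul, inner_add_left, real_inner_smul_left]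
    rw [h1, h2, inner_sub_right]
    push_cast
    ring
  rw [key, norm_mul, mul_pow, Complex.norm_exp, ← Real.exp_nat_mul]
  congr 2
  simp [-Complex.ofReal_pow]; ring

variable [BorelSpace V]

theorem aestronglyMeasurable_twistedGaussian_kernel (hf : AEStronglyMeasurable f μ)
    (c : ℝ) (x : V) : AEStronglyMeasurable (fun w => f w *
      Complex.exp (-(c * ‖x - w‖ ^ 2 : ℝ) + (inner ℝ (A x) w / 2 : ℝ) * Complex.I)) μ :=
  hf.mul (Continuous.aestronglyMeasurable (by fun_prop))

/-- Integrability of the twisted Gaussian kernel against exponentials of functions of linear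
growth. -/
theorem integrable_twistedGaussian_kernel_mul_exp (hf : AEStronglyMeasurable f μ)
    (hint : Integrable (fun w => ‖f w‖ * Real.exp (a * ‖w‖ ^ 2)) μ) (hL : 0 ≤ L)
    {c : ℝ} (hc : -(L / 4) ≤ c) (x : V) {g : V → ℝ} (hg : Continuous g)
    {b C r : ℝ} (hb : L / 4 + b < a) (hr : ‖x‖ ≤ r)
    (hgb : ∀ w, g w ≤ b * (r + ‖w‖) ^ 2 + C * (r + ‖w‖)) :
    Integrable (fun w => ‖f w *
      Complex.exp (-(c * ‖x - w‖ ^ 2 : ℝ) + (inner ℝ (A x) w / 2 : ℝ) * Complex.I)‖ *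
        Real.exp (g w)) μ := by
  have := integrable_norm_mul_exp_of_quadratic_bound (μ := μ) (C := C) (r := r)
    (g := fun w => -(c * ‖x - w‖ ^ 2) + g w) hf hint hb (by fun_prop) fun w => by
      have := neg_mul_norm_sub_sq_le (w := w) hc hL hr
      linarith [hgb w]
  refine this.congr (.of_forall fun w => ?_)
  simp only [norm_twistedGaussian_kernel, Real.exp_add, mul_assoc]

variable [FiniteDimensional ℝ V]

/-- One integrable majorant serves the whole cylinder, endpoint c = -L/4 included; this is what lets
the maximum principle work on a compact set. -/
theorem continuousOn_twistedGaussian (hf : AEStronglyMeasurable f μ)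
    (hint : Integrable (fun w => ‖f w‖ * Real.exp (a * ‖w‖ ^ 2)) μ) (hL : 0 ≤ L)
    (ha : L / 4 < a) (r : ℝ) :
    ContinuousOn (fun q : V × ℝ => twistedGaussian μ A f q.2 q.1)
      (Metric.closedBall 0 r ×ˢ Set.Icc (-(L / 4)) 0) := by
  have hA : Continuous A := A.continuous_of_finiteDimensional
  refine continuousOn_of_dominated
    (bound := fun w => ‖f w‖ * Real.exp (L / 4 * (r + ‖w‖) ^ 2))
    (fun q _ => aestronglyMeasurable_twistedGaussian_kernel hf q.2 q.1)
    (fun q hq => .of_forall fun w => ?_)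
    (integrable_norm_mul_exp_of_quadratic_bound (C := 0) (r := r) hf hint ha
      (by fun_prop) fun w => by simp)
    (.of_forall fun w => Continuous.continuousOn (by fun_prop))
  rw [norm_twistedGaussian_kernel]
  gcongr
  exact neg_mul_norm_sub_sq_le hq.2.1 hL (by simpa using hq.1)

end TwistedGaussian

/-- By Parseval the real squares give 4c²|y|² and -|Ay|²/4 = -L²|y|²/4, while the cross term is a
multiple of ⟨y,Ay⟩ = 0. This is where A² = -L² turns the spatial Laplacian into the second moment
that also governs ∂_c. -/
theorem sum_sq_twisted_linear_form {V : Type*} [NormedAddCommGroup V] [InnerProductSpace ℝ V]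
    {A : V →ₗ[ℝ] V} {L : ℝ} (hA : ∀ x y, inner ℝ (A x) y = -inner ℝ x (A y))
    (hA2 : ∀ x, A (A x) = -(L ^ 2) • x) {ι : Type*} [Fintype ι] (e : OrthonormalBasis ι ℝ V)
    (c : ℝ) (y : V) :
    ∑ i, (((-2 * c * inner ℝ y (e i) : ℝ) : ℂ) -
      ((inner ℝ (A (e i)) y / 2 : ℝ) : ℂ) * Complex.I) ^ 2
      = ((-(L ^ 2 / 4 - 4 * c ^ 2) * ‖y‖ ^ 2 : ℝ) : ℂ) := by
  have h1 : ∑ i, inner ℝ y (e i) ^ 2 = ‖y‖ ^ 2 := by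
    rw [← real_inner_self_eq_norm_sq, ← e.sum_inner_mul_inner y y]
    exact Finset.sum_congr rfl fun i _ => by rw [real_inner_comm y (e i)]; ring
  have h2 : ∑ i, inner ℝ (A (e i)) y ^ 2 = L ^ 2 * ‖y‖ ^ 2 := by
    have : inner ℝ (A y) (A y) = L ^ 2 * ‖y‖ ^ 2 := by
      rw [hA, hA2, inner_smul_right, real_inner_self_eq_norm_sq]; ring
    rw [← this, ← e.sum_inner_mul_inner (A y) (A y)]
    exact Finset.sum_congr rfl fun i _ => by
      rw [hA (e i) y, real_inner_comm (e i) (A y)]; ring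
  have h3 : ∑ i, inner ℝ y (e i) * inner ℝ (A (e i)) y = 0 := by
    have : inner ℝ y (A y) = 0 := by
      have := hA y y
      rw [real_inner_comm] at this
      linarith
    rw [← neg_eq_zero, ← this, ← e.sum_inner_mul_inner y (A y), ← Finset.sum_neg_distrib]
    exact Finset.sum_congr rfl fun i _ => by rw [hA]; ring
  have h : ∀ i, (((-2 * c * inner ℝ y (e i) : ℝ) : ℂ) -
      ((inner ℝ (A (e i)) y / 2 : ℝ) : ℂ) * Complex.I) ^ 2
      = ((4 * c ^ 2 * inner ℝ y (e i) ^ 2 - 1 / 4 * inner ℝ (A (e i)) y ^ 2 : ℝ) : ℂ) +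
        ((2 * c * (inner ℝ y (e i) * inner ℝ (A (e i)) y) : ℝ) : ℂ) * Complex.I := fun i => by
    push_cast
    linear_combination ((inner ℝ (A (e i)) y : ℂ) ^ 2 / 4) * Complex.I_sq
  simp only [h]
  rw [Finset.sum_add_distrib, ← Finset.sum_mul, ← Complex.ofReal_sum, ← Complex.ofReal_sum,
    Finset.sum_sub_distrib, ← Finset.mul_sum, ← Finset.mul_sum, ← Finset.mul_sum, h1, h2, h3]
  push_cast; ring

/-! ### The parabolic maximum principle and the vanishing of f -/

section MaximumPrinciple

variable {V : Type*} [NormedAddCommGroup V] [InnerProductSpace ℝ V] [FiniteDimensional ℝ V]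
  [MeasurableSpace V] [BorelSpace V] {μ : Measure V} {A : V →ₗ[ℝ] V} {f : V → ℂ} {a L : ℝ}

/-- The second moment `∫ f(w) |x - w|² K_c(x, w) dw` of the twisted Gaussian kernel. -/
noncomputable def twistedGaussianMoment (μ : Measure V) (A : V →ₗ[ℝ] V) (f : V → ℂ) (c : ℝ)
    (x : V) : ℂ :=
  ∫ w, f w * Complex.exp (-(c * ‖x - w‖ ^ 2 : ℝ) + (inner ℝ (A x) w / 2 : ℝ) * Complex.I) *
    (‖x - w‖ ^ 2 : ℝ) ∂μ

theorem hasDerivAt_norm_sq_twistedGaussian (hf : AEStronglyMeasurable f μ)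
    (hint : Integrable (fun w => ‖f w‖ * Real.exp (a * ‖w‖ ^ 2)) μ) (hL : 0 ≤ L)
    (ha : L / 4 < a) {c : ℝ} (hc : -(L / 4) ≤ c) (x : V) :
    HasDerivAt (fun c => ‖twistedGaussian μ A f c x‖ ^ 2)
      (-2 * inner ℝ (twistedGaussian μ A f c x) (twistedGaussianMoment μ A f c x)) c := by
  set R : ℝ := (a - L / 4) / 2 with hR
  have hR0 : 0 < R := by rw [hR]; linarith
  -- In the shifted parameter τ - c the means form an exponential family with ℓ = -‖x - w‖²; the gap
  -- a - L/4 provides its radius R.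
  have hE := hasDerivAt_integral_mul_cexp (μ := μ)
    (aestronglyMeasurable_twistedGaussian_kernel (A := A) hf c x)
    (ℓ := fun w => ((-‖x - w‖ ^ 2 : ℝ) : ℂ)) (R := R) (t := ((c - c : ℝ) : ℂ))
    (Continuous.aestronglyMeasurable (by fun_prop))
    (integrable_twistedGaussian_kernel_mul_exp hf hint hL hc x (b := R) (C := 0) (r := ‖x‖)
      (by fun_prop) (by rw [hR]; linarith) le_rfl fun w => by
        have h1 : ‖x - w‖ ≤ ‖x‖ + ‖w‖ := norm_sub_le _ _
        rw [Complex.norm_real, norm_neg, Real.norm_of_nonneg (by positivity), zero_mul, add_zero]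
        gcongr)
    (by simpa using hR0)
  have h2 := (hE.comp_ofReal.comp_sub_const c c).norm_sq
  have hU : ∀ τ : ℝ, ∫ w, f w *
      Complex.exp (-(c * ‖x - w‖ ^ 2 : ℝ) + (inner ℝ (A x) w / 2 : ℝ) * Complex.I) *
      Complex.exp (((τ - c : ℝ) : ℂ) * ((-‖x - w‖ ^ 2 : ℝ) : ℂ)) ∂μ
      = twistedGaussian μ A f τ x := fun τ => by
    refine integral_congr_ae (.of_forall fun w => ?_)
    simp only []
    rw [mul_assoc, ← Complex.exp_add]
    congr 2
    push_cast; ring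
  simp only [hU] at h2
  refine h2.congr_deriv ?_
  have : ∫ w, f w *
      Complex.exp (-(c * ‖x - w‖ ^ 2 : ℝ) + (inner ℝ (A x) w / 2 : ℝ) * Complex.I) *
      ((-‖x - w‖ ^ 2 : ℝ) : ℂ) *
      Complex.exp (((c - c : ℝ) : ℂ) * ((-‖x - w‖ ^ 2 : ℝ) : ℂ)) ∂μ
      = -twistedGaussianMoment μ A f c x := by
    rw [twistedGaussianMoment, ← integral_neg]
    refine integral_congr_ae (.of_forall fun w => ?_)
    simp
  rw [this, inner_neg_right]; ring

-- Along each basis vector e i, |U|² is e^{-2ct²} times the squared modulus of an exponential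
-- family, so the one-variable test applies; the sum over i collapses by
-- `sum_sq_twisted_linear_form`.
open Topology in
theorem twistedGaussian_second_order (hf : AEStronglyMeasurable f μ)
    (hint : Integrable (fun w => ‖f w‖ * Real.exp (a * ‖w‖ ^ 2)) μ) (hL : 0 ≤ L)
    (ha : L / 4 < a) (hA : ∀ x y, inner ℝ (A x) y = -inner ℝ x (A y))
    (hA2 : ∀ x, A (A x) = -(L ^ 2) • x) {c : ℝ} (hc : -(L / 4) ≤ c) {x : V}
    (hmax : IsLocalMax (fun x => ‖twistedGaussian μ A f c x‖ ^ 2) x) :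
    -4 * c * Module.finrank ℝ V * ‖twistedGaussian μ A f c x‖ ^ 2
      - 2 * (L ^ 2 / 4 - 4 * c ^ 2) *
        inner ℝ (twistedGaussian μ A f c x) (twistedGaussianMoment μ A f c x) ≤ 0 := by
  set e := stdOrthonormalBasis ℝ V
  set F : V → ℂ := fun w => f w *
    Complex.exp (-(c * ‖x - w‖ ^ 2 : ℝ) + (inner ℝ (A x) w / 2 : ℝ) * Complex.I) with hF
  set ℓ : Fin (Module.finrank ℝ V) → V → ℂ := fun i w =>
    ((-2 * c * inner ℝ (x - w) (e i) : ℝ) : ℂ) -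
      ((inner ℝ (A (e i)) (x - w) / 2 : ℝ) : ℂ) * Complex.I with hℓ
  have hFm : AEStronglyMeasurable F μ := aestronglyMeasurable_twistedGaussian_kernel hf c x
  have hℓc : ∀ i, Continuous (ℓ i) := fun i => by simp only [hℓ]; fun_prop
  have hℓb : ∀ i w, ‖ℓ i w‖ ≤ (2 * |c| + ‖A (e i)‖ / 2) * (‖x‖ + ‖w‖) := fun i w => by
    have h1 : ‖x - w‖ ≤ ‖x‖ + ‖w‖ := norm_sub_le _ _
    have h2 : |inner ℝ (x - w) (e i)| ≤ ‖x - w‖ := by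
      simpa using abs_real_inner_le_norm (x - w) (e i)
    have h3 : |inner ℝ (A (e i)) (x - w)| ≤ ‖A (e i)‖ * ‖x - w‖ := abs_real_inner_le_norm _ _
    calc ‖ℓ i w‖ ≤ 2 * |c| * |inner ℝ (x - w) (e i)| + |inner ℝ (A (e i)) (x - w)| / 2 := by
          refine (norm_sub_le _ _).trans (le_of_eq ?_)
          rw [norm_mul, Complex.norm_real, Complex.norm_real, Complex.norm_I, Real.norm_eq_abs,
            Real.norm_eq_abs, abs_mul, abs_mul, abs_div]
          norm_num
      _ ≤ 2 * |c| * ‖x - w‖ + ‖A (e i)‖ * ‖x - w‖ / 2 := by gcongr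
      _ = (2 * |c| + ‖A (e i)‖ / 2) * ‖x - w‖ := by ring
      _ ≤ _ := by gcongr
  have hFint : ∀ i, Integrable (fun w => ‖F w‖ * Real.exp (2 * ‖ℓ i w‖)) μ := fun i =>
    integrable_twistedGaussian_kernel_mul_exp hf hint hL hc x (b := 0)
      (C := 2 * (2 * |c| + ‖A (e i)‖ / 2)) (r := ‖x‖)
      (continuous_const.mul (hℓc i).norm) (by linarith) le_rfl fun w => by
        linarith [hℓb i w]
  have hFsq : ∀ i, Integrable (fun w => F w * ℓ i w ^ 2) μ := fun i => by
    refine (hFint i).mono' (hFm.mul ((hℓc i).pow 2).aestronglyMeasurable) (.of_forall fun w => ?_)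
    rw [norm_mul, norm_pow]
    gcongr
    have h1 : ‖ℓ i w‖ ≤ Real.exp ‖ℓ i w‖ := by linarith [Real.add_one_le_exp ‖ℓ i w‖]
    calc ‖ℓ i w‖ ^ 2 ≤ Real.exp ‖ℓ i w‖ ^ 2 := by gcongr
      _ = _ := by rw [← Real.exp_nat_mul]; norm_num
  have hU : ∫ w, F w ∂μ = twistedGaussian μ A f c x := rfl
  have hi : ∀ i, -4 * c * ‖twistedGaussian μ A f c x‖ ^ 2 +
      2 * inner ℝ (twistedGaussian μ A f c x) (∫ w, F w * ℓ i w ^ 2 ∂μ) ≤ 0 := fun i => by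
    rw [← hU]
    refine gaussian_mul_exponentialFamily_second_order c hFm (hℓc i).aestronglyMeasurable
      (hFint i) ?_
    have hline : ContinuousAt (fun t : ℝ => x + t • e i) 0 :=
      (by fun_prop : Continuous fun t : ℝ => x + t • e i).continuousAt
    have hm : IsLocalMax ((fun x => ‖twistedGaussian μ A f c x‖ ^ 2) ∘
        fun t : ℝ => x + t • e i) 0 :=
      IsLocalMax.comp_continuous (by simpa using hmax) hline
    refine hm.congr (.of_forall fun t => ?_)
    exact norm_sq_twistedGaussian_add_smul c x (e i) (by simp) t
  have hs := Finset.sum_nonpos fun i (_ : i ∈ Finset.univ) => hi i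
  rw [Finset.sum_add_distrib, ← Finset.mul_sum, ← Finset.mul_sum, ← inner_sum,
    ← integral_finsetSum _ fun i _ => hFsq i] at hs
  have hsum : ∫ w, ∑ i, F w * ℓ i w ^ 2 ∂μ
      = (-(L ^ 2 / 4 - 4 * c ^ 2)) • twistedGaussianMoment μ A f c x := by
    rw [twistedGaussianMoment, ← integral_smul]
    refine integral_congr_ae (.of_forall fun w => ?_)
    simp only []
    rw [← Finset.mul_sum, sum_sq_twisted_linear_form hA hA2 e c (x - w), Complex.real_smul]
    simp only [hF]
    push_cast
    ring
  rw [hsum, inner_smul_right] at hs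
  simp only [Finset.sum_const, Finset.card_univ, Fintype.card_fin, nsmul_eq_mul] at hs
  linarith

open Filter Topology in
/-- The parabolic maximum principle for twisted Gaussian means: if they vanish on `∂Ω` for all
parameters in `[-L/4, 0]`, then they vanish in `Ω`. -/
theorem twistedGaussian_eq_zero_of_frontier (hf : AEStronglyMeasurable f μ)
    (hint : Integrable (fun w => ‖f w‖ * Real.exp (a * ‖w‖ ^ 2)) μ) (hL : 0 < L)
    (ha : L / 4 < a) (hA : ∀ x y, inner ℝ (A x) y = -inner ℝ x (A y))
    (hA2 : ∀ x, A (A x) = -(L ^ 2) • x) {n : ℕ} (hn : n ≠ 0)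
    (hdim : Module.finrank ℝ V = 2 * n) {Ω : Set V} (hΩ : IsOpen Ω)
    (hΩb : Bornology.IsBounded Ω)
    (hvan : ∀ x ∈ frontier Ω, ∀ c ∈ Set.Icc (-(L / 4)) 0, twistedGaussian μ A f c x = 0)
    {x : V} (hx : x ∈ Ω) {c : ℝ} (hc : c ∈ Set.Ioc (-(L / 4)) 0) :
    twistedGaussian μ A f c x = 0 := by
  set P : ℝ → ℝ := fun c => L ^ 2 / 4 - 4 * c ^ 2 with hP
  have hP0 : ∀ c ∈ Set.Ioc (-(L / 4)) 0, 0 < P c := fun c hc => by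
    simp only [hP]; nlinarith [hc.1, hc.2]
  set v : V × ℝ → ℝ := fun q => P q.2 ^ n * ‖twistedGaussian μ A f q.2 q.1‖ ^ 2 with hv
  obtain ⟨r, hr⟩ := hΩb.closure.subset_closedBall (0 : V)
  set K : Set (V × ℝ) := closure Ω ×ˢ Set.Icc (-(L / 4)) 0 with hK
  have hKc : IsCompact K := hΩb.isCompact_closure.prod isCompact_Icc
  have hvc : ContinuousOn v K :=
    ContinuousOn.mul (Continuous.continuousOn (by simp only [hP]; fun_prop))
      (((continuousOn_twistedGaussian hf hint hL.le ha r).mono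
        (Set.prod_mono hr le_rfl)).norm.pow 2)
  by_contra hne
  have hpos : 0 < v (x, c) := mul_pos (pow_pos (hP0 c hc) n) (by positivity)
  -- The penalty δ(c + L/4) makes the time inequality strict, and this δ costs only half of v (x,
  -- c), so v stays positive at the maximiser of v minus the penalty.
  set δ : ℝ := v (x, c) / (2 * (c + L / 4)) with hδ
  have hcL : 0 < c + L / 4 := by linarith [hc.1]
  have hδ0 : 0 < δ := by positivity
  obtain ⟨⟨x₀, c₀⟩, hq, hmax⟩ := hKc.exists_isMaxOn
    ⟨(x, c), subset_closure hx, hc.1.le, hc.2⟩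
    (hvc.sub (Continuous.continuousOn (by fun_prop :
      Continuous fun q : V × ℝ => δ * (q.2 + L / 4))))
  have hmax' : ∀ x' ∈ closure Ω, ∀ c' ∈ Set.Icc (-(L / 4)) 0,
      v (x', c') - δ * (c' + L / 4) ≤ v (x₀, c₀) - δ * (c₀ + L / 4) := fun x' hx' c' hc' =>
    hmax (show (x', c') ∈ K from ⟨hx', hc'⟩)
  have hc₀ : c₀ ∈ Set.Icc (-(L / 4)) 0 := hq.2
  have hgt : 0 < v (x₀, c₀) := by
    have h1 := hmax' x (subset_closure hx) c ⟨hc.1.le, hc.2⟩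
    have h2 : δ * (c + L / 4) = v (x, c) / 2 := by
      rw [hδ, div_mul_eq_mul_div, mul_div_mul_right _ _ hcL.ne']
    have h3 : 0 ≤ δ * (c₀ + L / 4) := mul_nonneg hδ0.le (by linarith [hc₀.1])
    linarith
  have hc₀' : c₀ ∈ Set.Ioc (-(L / 4)) 0 := by
    refine ⟨lt_of_le_of_ne hc₀.1 fun h => ?_, hc₀.2⟩
    have : P c₀ = 0 := by simp only [hP, ← h]; ring
    simp [hv, this, hn] at hgt
  have hx₀ : x₀ ∈ Ω := by
    by_contra hx₀
    have : x₀ ∈ frontier Ω := by rw [hΩ.frontier_eq]; exact ⟨hq.1, hx₀⟩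
    simp [hv, hvan x₀ this c₀ hc₀] at hgt
  have hspace : IsLocalMax (fun x => ‖twistedGaussian μ A f c₀ x‖ ^ 2) x₀ := by
    filter_upwards [hΩ.mem_nhds hx₀] with x' hx'
    have := hmax' x' (subset_closure hx') c₀ hc₀
    exact le_of_mul_le_mul_left (by simpa [hv] using this) (pow_pos (hP0 c₀ hc₀') n)
  have h2 := twistedGaussian_second_order hf hint hL.le ha hA hA2 hc₀.1 hspace
  set U := twistedGaussian μ A f c₀ x₀
  set W := twistedGaussianMoment μ A f c₀ x₀
  have hPd : HasDerivAt (fun c => P c ^ n) (n * P c₀ ^ (n - 1) * (-8 * c₀)) c₀ := by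
    have := ((((hasDerivAt_id c₀).pow 2).const_mul 4).const_sub (L ^ 2 / 4)).pow n
    exact this.congr_deriv (by simp only [hP, Pi.pow_apply, id, Nat.cast_ofNat]; ring)
  -- Only earlier times are compared, because c₀ may be the endpoint 0. The result ∂_c v ≥ δ > 0
  -- contradicts the spatial test.
  have htime := ((hPd.mul (hasDerivAt_norm_sq_twistedGaussian hf hint hL.le ha hc₀.1 x₀)).sub
    (((hasDerivAt_id c₀).add_const (L / 4)).const_mul δ)).nonneg_of_forall_left_le (by
      filter_upwards [Ioo_mem_nhdsLT hc₀'.1] with c' hc'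
      exact hmax' x₀ hq.1 c' ⟨hc'.1.le, by linarith [hc'.2, hc₀.2]⟩)
  have hPn : P c₀ * P c₀ ^ (n - 1) = P c₀ ^ n := mul_pow_sub_one hn _
  -- The exponent n is half the real dimension, which matches -8nc with -4c dim V.
  have h3 : P c₀ * (n * P c₀ ^ (n - 1) * (-8 * c₀) * ‖U‖ ^ 2 +
      P c₀ ^ n * (-2 * inner ℝ U W)) =
      P c₀ ^ n * (-4 * c₀ * Module.finrank ℝ V * ‖U‖ ^ 2 - 2 * P c₀ * inner ℝ U W) := by
    rw [hdim]; push_cast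
    linear_combination (n * (-8 * c₀) * ‖U‖ ^ 2) * hPn
  have h4 := mul_nonpos_of_nonneg_of_nonpos (pow_pos (hP0 c₀ hc₀') n).le h2
  have h5 := mul_pos (hP0 c₀ hc₀') hδ0
  have h6 := mul_nonneg (hP0 c₀ hc₀').le htime
  rw [mul_one, mul_sub] at h6
  change 0 ≤ P c₀ * (n * P c₀ ^ (n - 1) * (-8 * c₀) * ‖U‖ ^ 2 +
      P c₀ ^ n * (-2 * inner ℝ U W)) - P c₀ * δ at h6
  change P c₀ ^ n * (-4 * c₀ * Module.finrank ℝ V * ‖U‖ ^ 2 - 2 * P c₀ * inner ℝ U W) ≤ 0 at h4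
  rw [h3] at h6
  linarith

open Filter Topology in
theorem ae_eq_zero_of_twistedGaussian_frontier (hf : AEStronglyMeasurable f μ)
    (hint : Integrable (fun w => ‖f w‖ * Real.exp (a * ‖w‖ ^ 2)) μ) (hL : 0 < L)
    (ha : L / 4 < a) (hA : ∀ x y, inner ℝ (A x) y = -inner ℝ x (A y))
    (hA2 : ∀ x, A (A x) = -(L ^ 2) • x) {n : ℕ} (hn : n ≠ 0)
    (hdim : Module.finrank ℝ V = 2 * n) {Ω : Set V} (hΩ : IsOpen Ω) (hΩn : Ω.Nonempty)
    (hΩb : Bornology.IsBounded Ω)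
    (hvan : ∀ x ∈ frontier Ω, ∀ c ∈ Set.Icc (-(L / 4)) 0, twistedGaussian μ A f c x = 0) :
    f =ᵐ[μ] 0 := by
  obtain ⟨x₀, hx₀⟩ := hΩn
  have hzero : ∀ x ∈ Ω, twistedGaussian μ A f 0 x = 0 := fun x hx =>
    twistedGaussian_eq_zero_of_frontier hf hint hL ha hA hA2 hn hdim hΩ hΩb hvan hx
      ⟨by linarith, le_rfl⟩
  -- On the line x₀ + tξ the mean extends to an entire function of t, which vanishes for small real
  -- t.
  have hall : ∀ ξ : V, twistedGaussian μ A f 0 (x₀ + ξ) = 0 := fun ξ => by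
    set F : V → ℂ := fun w => f w * Complex.exp ((inner ℝ (A x₀) w / 2 : ℝ) * Complex.I)
    set ℓ : V → ℂ := fun w => (inner ℝ (A ξ) w / 2 : ℝ) * Complex.I
    have hℓc : Continuous ℓ := by fun_prop
    have hFm : AEStronglyMeasurable F μ := hf.mul (Continuous.aestronglyMeasurable (by fun_prop))
    have hFint : ∀ R : ℝ, 0 ≤ R → Integrable (fun w => ‖F w‖ * Real.exp (R * ‖ℓ w‖)) μ :=
      fun R hR => by
        have := integrable_norm_mul_exp_of_quadratic_bound (b := 0) (C := R * (‖A ξ‖ / 2))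
          (r := 0) hf hint (by linarith) (g := fun w => R * ‖ℓ w‖) (by fun_prop) fun w => by
            have h3 : |inner ℝ (A ξ) w| ≤ ‖A ξ‖ * ‖w‖ := abs_real_inner_le_norm _ _
            have h4 : ‖ℓ w‖ = |inner ℝ (A ξ) w| / 2 := by
              rw [norm_mul, Complex.norm_real, Complex.norm_I, Real.norm_eq_abs, abs_div]
              norm_num
            rw [h4]
            nlinarith
        refine this.congr (.of_forall fun w => ?_)
        simp only [F]
        rw [norm_mul (f w), Complex.norm_exp_ofReal_mul_I, mul_one]
    have hd : Differentiable ℂ fun t : ℂ => ∫ w, F w * Complex.exp (t * ℓ w) ∂μ := fun t =>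
      (hasDerivAt_integral_mul_cexp hFm hℓc.aestronglyMeasurable
        (hFint (‖t‖ + 1) (by positivity)) (by linarith)).differentiableAt
    have hline : ∀ t : ℝ, ∫ w, F w * Complex.exp (t * ℓ w) ∂μ
        = twistedGaussian μ A f 0 (x₀ + t • ξ) := fun t => by
      rw [twistedGaussian_zero_eq]
      refine integral_congr_ae (.of_forall fun w => ?_)
      simp only [F, ℓ]
      rw [mul_assoc, ← Complex.exp_add, map_add, map_smul, inner_add_left, real_inner_smul_left]
      congr 2
      push_cast; ring
    have hnear : ∀ᶠ t : ℝ in 𝓝 0, ∫ w, F w * Complex.exp (t * ℓ w) ∂μ = 0 := by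
      have hcl : ContinuousAt (fun t : ℝ => x₀ + t • ξ) 0 :=
        (by fun_prop : Continuous fun t : ℝ => x₀ + t • ξ).continuousAt
      filter_upwards [hcl.preimage_mem_nhds (hΩ.mem_nhds (by simpa using hx₀))] with t ht
      rw [hline]
      exact hzero _ ht
    have hfreq : ∃ᶠ t : ℂ in 𝓝[≠] 0, ∫ w, F w * Complex.exp (t * ℓ w) ∂μ = 0 := by
      have hto : Tendsto (fun t : ℝ => (t : ℂ)) (𝓝[≠] 0) (𝓝[≠] 0) :=
        tendsto_nhdsWithin_of_tendsto_nhds_of_eventually_within _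
          ((Complex.continuous_ofReal.tendsto' 0 0 (by simp)).mono_left nhdsWithin_le_nhds)
          (by filter_upwards [self_mem_nhdsWithin] with t ht; simpa using ht)
      exact hto.frequently (hnear.filter_mono nhdsWithin_le_nhds).frequently
    have := AnalyticOnNhd.eq_of_frequently_eq (g := fun _ => (0 : ℂ))
      (fun z _ => hd.analyticAt z) (fun z _ => analyticAt_const) hfreq
    have h1 := hline 1
    rw [one_smul] at h1
    rw [← h1]
    exact congrFun this _
  have hfI : Integrable f μ := by
    have := integrable_norm_mul_exp_of_quadratic_bound (b := 0) (C := 0) (r := 0)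
      hf hint (by linarith) (g := fun _ => 0) continuous_const (by simp)
    exact (integrable_norm_iff hf).1 (by simpa using this)
  refine hfI.ae_eq_zero_of_integral_char_eq_zero fun ξ => ?_
  -- This point x₀ + (…) = -(2/L²)Aξ is the preimage of ξ under A/2, since A² = -L².
  have := hall (-x₀ + (-(2 / L ^ 2)) • A ξ)
  rw [add_neg_cancel_left, twistedGaussian_zero_eq] at this
  rw [← this]
  refine integral_congr_ae (.of_forall fun w => ?_)
  simp only []
  congr 4
  rw [map_smul, hA2, smul_smul, real_inner_smul_left, real_inner_comm]
  field_simp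

end MaximumPrinciple

/-! ### Polar integration and passage from L^p to L¹ -/

/-- If the integrals of `g` over almost all spheres centred at the origin vanish, then so does the
integral of `g`. -/
theorem MeasureTheory.integral_eq_zero_of_sphere_integrals {E : Type*} [NormedAddCommGroup E]
    [NormedSpace ℝ E]
    [FiniteDimensional ℝ E] [MeasurableSpace E] [BorelSpace E] [Nontrivial E] (μ : Measure E)
    [μ.IsAddHaarMeasure] {g : E → ℂ} (hg : Integrable g μ)
    (h : ∀ᵐ r : ℝ, 0 < r → ∫ ω, g (r • (ω : E)) ∂μ.toSphere = 0) : ∫ x, g x ∂μ = 0 := by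
  set d := Module.finrank ℝ E - 1
  set G : Metric.sphere (0 : E) 1 × Set.Ioi (0 : ℝ) → ℂ := fun q => g (q.2.1 • q.1.1) with hG
  have hcomp : (fun x : ({(0 : E)}ᶜ : Set E) => g x) = G ∘ homeomorphUnitSphereProd E := by
    funext x
    have : ‖(x : E)‖ ≠ 0 := norm_ne_zero_iff.2 x.2
    simp [hG, smul_smul, mul_inv_cancel₀ this]
  have hGi : Integrable G (μ.toSphere.prod (.volumeIoiPow d)) := by
    rw [← μ.measurePreserving_homeomorphUnitSphereProd.integrable_comp_emb
      (Homeomorph.measurableEmbedding _), ← hcomp]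
    have := (integrableOn_iff_comap_subtypeVal (f := g) (μ := μ)
      (measurableSet_singleton (0 : E)).compl).1 hg.integrableOn
    exact this
  calc ∫ x, g x ∂μ = ∫ x : ({(0)}ᶜ : Set E), g x ∂(μ.comap (↑)) := by
        rw [integral_subtype_comap (measurableSet_singleton _).compl g,
          restrict_compl_singleton]
    _ = ∫ q, G q ∂μ.toSphere.prod (.volumeIoiPow d) := by
        rw [hcomp]
        exact μ.measurePreserving_homeomorphUnitSphereProd.integral_comp
          (Homeomorph.measurableEmbedding _) G
    _ = ∫ r, ∫ ω, G (ω, r) ∂μ.toSphere ∂(.volumeIoiPow d) := integral_prod_symm _ hGi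
    _ = 0 := by
        refine integral_eq_zero_of_ae ?_
        have h1 : ∀ᵐ r : Set.Ioi (0 : ℝ) ∂(volume.comap Subtype.val),
            0 < (r : ℝ) → ∫ ω, g ((r : ℝ) • (ω : E)) ∂μ.toSphere = 0 := by
          have := (ae_restrict_of_ae (s := Set.Ioi (0 : ℝ)) h)
          rwa [← map_comap_subtype_coe measurableSet_Ioi,
            (MeasurableEmbedding.subtype_coe measurableSet_Ioi).ae_map_iff] at this
        have h2 := (withDensity_absolutelyContinuous _
          fun r : Set.Ioi (0 : ℝ) => ENNReal.ofReal (r.1 ^ d)).ae_le h1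
        filter_upwards [h2] with r hr using hr r.2

/-- A function with Gaussian decay in the `L^p` sense has Gaussian decay in the `L^1` sense, at any
slower rate. -/
theorem MeasureTheory.MemLp.integrable_norm_mul_exp_sq {V : Type*} [NormedAddCommGroup V]
    [InnerProductSpace ℝ V] [FiniteDimensional ℝ V] [MeasurableSpace V] [BorelSpace V]
    {f : V → ℂ} {a b : ℝ} (hab : a < b) {p : ENNReal} (hp : 1 ≤ p)
    (hf : MemLp (fun z => f z * ((Real.exp (b * ‖z‖ ^ 2) : ℝ) : ℂ)) p volume) :
    AEStronglyMeasurable f volume ∧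
      Integrable (fun z => ‖f z‖ * Real.exp (a * ‖z‖ ^ 2)) volume := by
  have hfm : AEStronglyMeasurable f volume := by
    have := hf.1.mul (Continuous.aestronglyMeasurable
      (by fun_prop : Continuous fun z : V => ((Real.exp (-b * ‖z‖ ^ 2) : ℝ) : ℂ)))
    refine this.congr (.of_forall fun z => ?_)
    simp only [Pi.mul_apply]
    rw [mul_assoc, ← Complex.ofReal_mul, ← Real.exp_add]
    simp
  refine ⟨hfm, ?_⟩
  -- The measure with density k ≤ 1 is finite and below `volume`, so L^p for `volume` embeds in L¹
  -- for it, without Hölder.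
  set k : V → NNReal := fun z => (Real.exp (-(b - a) * ‖z‖ ^ 2)).toNNReal with hk
  have hkm : Measurable k := (Continuous.measurable (by fun_prop)).real_toNNReal
  set ν : Measure V := volume.withDensity fun z => (k z : ENNReal) with hν
  have hgauss : Integrable (fun z : V => Real.exp (-(b - a) * ‖z‖ ^ 2)) volume := by
    have := GaussianFourier.integrable_cexp_neg_mul_sq_norm_add (V := V)
      (b := ((b - a : ℝ) : ℂ)) (by simpa using hab) 0 0
    refine this.norm.congr (.of_forall fun z => ?_)
    simp [Complex.norm_exp, -Complex.ofReal_pow, ← Complex.ofReal_pow]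
  have : IsFiniteMeasure ν := isFiniteMeasure_withDensity_ofReal hgauss.2
  have hle : ν ≤ volume := by
    calc ν ≤ volume.withDensity 1 := withDensity_mono (.of_forall fun z => by
          simp only [Pi.one_apply, hk]
          norm_cast
          rw [Real.toNNReal_le_one]
          exact Real.exp_le_one_iff.2 (by nlinarith [sq_nonneg ‖z‖]))
      _ = volume := withDensity_one
  have h1 := memLp_one_iff_integrable.1 ((hf.mono_measure hle).mono_exponent hp)
  rw [hν, integrable_withDensity_iff_integrable_smul hkm] at h1
  refine h1.norm.congr (.of_forall fun z => ?_)
  simp only []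
  rw [NNReal.smul_def, norm_smul, norm_mul, Complex.norm_real,
    Real.norm_of_nonneg (Real.exp_pos _).le, hk, Real.coe_toNNReal _ (Real.exp_pos _).le,
    Real.norm_of_nonneg (Real.exp_pos _).le, mul_left_comm, ← Real.exp_add]
  ring_nf

/-! ### Structure matrices of an H-type algebra -/

section HType

variable {𝔤 : Type*} [LieRing 𝔤] [LieAlgebra ℝ 𝔤] {ip : LinearMap.BilinForm ℝ 𝔤}

namespace AdaptedFrame

variable {n m : ℕ} (F : AdaptedFrame ip n m) (lam : EuclideanSpace ℝ (Fin m))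

/-- The matrix `∑ₖ λₖ U⁽ᵏ⁾`. -/
noncomputable def phaseMatrix : Matrix (Fin n ⊕ Fin n) (Fin n ⊕ Fin n) ℝ :=
  ∑ k, lam k • F.structureMatrix k

/-- The central vector `∑ₖ λₖ C_k`. -/
def centralVector : 𝔤 := ∑ k, lam k • F.C k

theorem ip_centralVector_self :
    ip (F.centralVector lam) (F.centralVector lam) = ‖lam‖ ^ 2 := by
  rw [EuclideanSpace.norm_sq_eq]
  simp [centralVector, F.C_orthonormal, pow_two]

theorem phaseMatrix_apply (hG : IsHTypeLieAlgebra ip) (i j : Fin n ⊕ Fin n) :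
    F.phaseMatrix lam i j = ip (F.centralVector lam) ⁅F.B i, F.B j⁆ := by
  simp [phaseMatrix, centralVector, structureMatrix, Matrix.sum_apply, hG.ip_symm (F.C _)]

theorem phaseMatrix_transpose (hG : IsHTypeLieAlgebra ip) :
    (F.phaseMatrix lam).transpose = -F.phaseMatrix lam := by
  ext i j
  rw [Matrix.transpose_apply, Matrix.neg_apply, phaseMatrix_apply F lam hG,
    phaseMatrix_apply F lam hG, ← lie_skew, map_neg]

theorem B_mem (i : Fin n ⊕ Fin n) : F.B i ∈ horizontalSpace ip :=
  F.B_span ▸ Submodule.subset_span ⟨i, rfl⟩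

theorem eq_sum_ip_smul_B {X : 𝔤} (hX : X ∈ horizontalSpace ip) :
    X = ∑ i, ip X (F.B i) • F.B i := by
  rw [← F.B_span] at hX
  obtain ⟨c, rfl⟩ := (Submodule.mem_span_range_iff_exists_fun ℝ).1 hX
  simp [F.B_orthonormal]

theorem centralVector_mem : F.centralVector lam ∈ LieAlgebra.center ℝ 𝔤 := by
  have h : F.centralVector lam ∈ (LieAlgebra.center ℝ 𝔤).toSubmodule := by
    rw [← F.C_span]
    exact Submodule.sum_mem _ fun k _ =>
      Submodule.smul_mem _ _ (Submodule.subset_span ⟨k, rfl⟩)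
  exact h

/-- The rows of the phase matrix are the coordinates of J B_i for Z = ∑ λₖ C_k, so its square
represents J² = -|Z|² with |Z| = |λ|. -/
theorem phaseMatrix_mul_self (hG : IsHTypeLieAlgebra ip) :
    F.phaseMatrix lam * F.phaseMatrix lam = -(‖lam‖ ^ 2) • (1 : Matrix _ _ ℝ) := by
  obtain ⟨J, hJ, hJ2⟩ := hG.J_sq _ (F.centralVector_mem lam)
  have hJB : ∀ i j, ip (J ⟨F.B i, F.B_mem i⟩ : 𝔤) (F.B j) = F.phaseMatrix lam i j := fun i j => by
    rw [phaseMatrix_apply F lam hG]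
    exact hJ ⟨F.B i, F.B_mem i⟩ ⟨F.B j, F.B_mem j⟩
  have hexp : ∀ i, J ⟨F.B i, F.B_mem i⟩
      = ∑ j, F.phaseMatrix lam i j • (⟨F.B j, F.B_mem j⟩ : horizontalSpace ip) := fun i => by
    refine Subtype.ext ?_
    rw [F.eq_sum_ip_smul_B (J ⟨F.B i, F.B_mem i⟩).2]
    simp [hJB]
  ext i k
  have h1 : ip (J (J ⟨F.B i, F.B_mem i⟩) : 𝔤) (F.B k) =
      ip ((-(ip (F.centralVector lam) (F.centralVector lam)) •
        (⟨F.B i, F.B_mem i⟩ : horizontalSpace ip) : horizontalSpace ip) : 𝔤) (F.B k) := by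
    rw [hJ2]
  rw [hexp i, map_sum] at h1
  simp only [map_smul, Submodule.coe_sum, Submodule.coe_smul, map_sum, LinearMap.sum_apply,
    LinearMap.smul_apply, hJB, F.ip_centralVector_self lam, F.B_orthonormal, smul_eq_mul] at h1
  rw [Matrix.mul_apply, h1, Matrix.smul_apply, Matrix.one_apply, smul_eq_mul]

/-- If 𝔟 were zero, every vector would equal its projection to the centre and 𝔤 would be abelian.
Positivity of n makes Pⁿ vanish at c = -L/4 and ℂⁿ nontrivial. -/
theorem index_ne_zero {n m : ℕ} (F : AdaptedFrame ip n m) (hG : IsHTypeLieAlgebra ip) : n ≠ 0 := by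
  rintro rfl
  obtain ⟨X, Y, hXY⟩ := hG.not_abelian
  have hb : horizontalSpace ip = ⊥ := by rw [← F.B_span]; simp
  have hcen : ∀ Z : 𝔤, Z ∈ LieAlgebra.center ℝ 𝔤 := fun Z => by
    set Z' : 𝔤 := ∑ k, ip Z (F.C k) • F.C k with hZ'
    have hZc : Z' ∈ (LieAlgebra.center ℝ 𝔤).toSubmodule := by
      rw [← F.C_span]
      exact Submodule.sum_mem _ fun k _ =>
        Submodule.smul_mem _ _ (Submodule.subset_span ⟨k, rfl⟩)
    have hmem : Z - Z' ∈ horizontalSpace ip := by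
      intro W hW
      rw [← F.C_span] at hW
      change ip W (Z - Z') = 0
      obtain ⟨c, rfl⟩ := (Submodule.mem_span_range_iff_exists_fun ℝ).1 hW
      simp [hZ', F.C_orthonormal, hG.ip_symm (F.C _) Z]
    rw [hb, Submodule.mem_bot, sub_eq_zero] at hmem
    rw [hmem]; exact hZc
  refine hXY ?_
  rw [← lie_skew, (LieModule.mem_maxTrivSubmodule ℝ 𝔤 𝔤 X).1 (hcen X) Y, neg_zero]

end AdaptedFrame

end HType

/-! ### Transfer to ℂⁿ and the theorem -/

/-- The identification of `ℂⁿ` with `ℝ²ⁿ` as a linear map. -/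
def realCoordsLinear (n : ℕ) : EuclideanSpace ℂ (Fin n) →ₗ[ℝ] (Fin n ⊕ Fin n → ℝ) where
  toFun := realCoords
  map_add' z w := by ext (j | j) <;> simp [realCoords]
  map_smul' c z := by ext (j | j) <;> simp [realCoords]

/-- The identification of `ℝ²ⁿ` with `ℂⁿ` as a linear map. -/
noncomputable def complexificationLinear (n : ℕ) :
    (Fin n ⊕ Fin n → ℝ) →ₗ[ℝ] EuclideanSpace ℂ (Fin n) where
  toFun := complexification
  map_add' x y := by ext j; simp [complexification]; ring
  map_smul' c x := by ext j; simp [complexification]; ring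

theorem realCoords_complexification {n : ℕ} (x : Fin n ⊕ Fin n → ℝ) :
    realCoords (complexification x) = x := by
  ext (j | j) <;> simp [realCoords, complexification]

theorem complexification_realCoords {n : ℕ} (z : EuclideanSpace ℂ (Fin n)) :
    complexification (realCoords z) = z := by
  ext j; simp [realCoords, complexification]

theorem inner_eq_realCoords_dotProduct {n : ℕ} (z w : EuclideanSpace ℂ (Fin n)) :
    inner ℝ z w = dotProduct (realCoords z) (realCoords w) := by
  simp [PiLp.inner_apply, dotProduct, realCoords, Complex.inner, Finset.sum_add_distrib,
    mul_comm]

namespace AdaptedFrame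

variable {𝔤 : Type*} [LieRing 𝔤] [LieAlgebra ℝ 𝔤] {ip : LinearMap.BilinForm ℝ 𝔤}
  {n m : ℕ} (F : AdaptedFrame ip n m) (lam : EuclideanSpace ℝ (Fin m))

/-- The real-linear map of `ℂⁿ` with matrix `∑ₖ λₖ U⁽ᵏ⁾`. -/
noncomputable def phaseMap : EuclideanSpace ℂ (Fin n) →ₗ[ℝ] EuclideanSpace ℂ (Fin n) :=
  complexificationLinear n ∘ₗ (F.phaseMatrix lam).mulVecLin ∘ₗ realCoordsLinear n

theorem realCoords_phaseMap (z : EuclideanSpace ℂ (Fin n)) :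
    realCoords (F.phaseMap lam z) = (F.phaseMatrix lam).mulVec (realCoords z) :=
  realCoords_complexification _

theorem inner_phaseMap_left (hG : IsHTypeLieAlgebra ip) (z w : EuclideanSpace ℂ (Fin n)) :
    inner ℝ (F.phaseMap lam z) w = -inner ℝ z (F.phaseMap lam w) := by
  rw [inner_eq_realCoords_dotProduct, inner_eq_realCoords_dotProduct, realCoords_phaseMap,
    realCoords_phaseMap, Matrix.dotProduct_mulVec, ← Matrix.mulVec_transpose,
    F.phaseMatrix_transpose lam hG, Matrix.neg_mulVec, neg_dotProduct, neg_neg]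

theorem phaseMap_phaseMap (hG : IsHTypeLieAlgebra ip) (z : EuclideanSpace ℂ (Fin n)) :
    F.phaseMap lam (F.phaseMap lam z) = -(‖lam‖ ^ 2) • z := by
  rw [← complexification_realCoords (F.phaseMap lam (F.phaseMap lam z)), realCoords_phaseMap,
    realCoords_phaseMap, Matrix.mulVec_mulVec, F.phaseMatrix_mul_self lam hG, Matrix.smul_mulVec,
    Matrix.one_mulVec]
  exact ((complexificationLinear n).map_smul _ _).trans
    (congrArg _ (complexification_realCoords z))

theorem phase_eq_inner (z w : EuclideanSpace ℂ (Fin n)) :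
    F.phase lam z w = inner ℝ z (F.phaseMap lam w) := by
  have h : ∀ k, (∑ j, z j * (starRingEnd ℂ)
      (complexification ((F.structureMatrix k).mulVec (realCoords w)) j)).re
      = dotProduct (realCoords z) ((F.structureMatrix k).mulVec (realCoords w)) := fun k => by
    rw [← realCoords_complexification ((F.structureMatrix k).mulVec (realCoords w)),
      ← inner_eq_realCoords_dotProduct, realCoords_complexification, PiLp.inner_apply,
      Complex.re_sum]
    exact Finset.sum_congr rfl fun j _ => by rw [Complex.inner, mul_comm]; simp [mul_comm]
  rw [inner_eq_realCoords_dotProduct, realCoords_phaseMap, phase, phaseMatrix, Matrix.sum_mulVec,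
    dotProduct_sum]
  exact Finset.sum_congr rfl fun k _ => by rw [h, Matrix.smul_mulVec, dotProduct_smul, smul_eq_mul]

theorem inner_phaseMap_self (hG : IsHTypeLieAlgebra ip) (z : EuclideanSpace ℂ (Fin n)) :
    inner ℝ (F.phaseMap lam z) z = 0 := by
  have := F.inner_phaseMap_left lam hG z z
  rw [real_inner_comm z (F.phaseMap lam z)] at this
  rw [real_inner_comm]
  linarith

/-- The twisted spherical mean in terms of the unnormalized measure on the unit sphere. -/
theorem twistedSphericalMean_eq (f : EuclideanSpace ℂ (Fin n) → ℂ) {s : ℝ} (hs : 0 < s)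
    (z : EuclideanSpace ℂ (Fin n)) :
    F.twistedSphericalMean lam f s z =
      (((volume : Measure (EuclideanSpace ℂ (Fin n))).toSphere Set.univ)⁻¹).toReal •
        ∫ ω, f (z - s • (ω : EuclideanSpace ℂ (Fin n))) *
          Complex.exp (Complex.I / 2 *
            (F.phase lam z (s • (ω : EuclideanSpace ℂ (Fin n))) : ℂ))
          ∂(volume : Measure (EuclideanSpace ℂ (Fin n))).toSphere := by
  have hemb : MeasurableEmbedding (fun ω : Metric.sphere (0 : EuclideanSpace ℂ (Fin n)) 1 =>
      s • (ω : EuclideanSpace ℂ (Fin n))) :=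
    (Homeomorph.smulOfNeZero s hs.ne').measurableEmbedding.comp
      (MeasurableEmbedding.subtype_coe Metric.isClosed_sphere.measurableSet)
  rw [twistedSphericalMean, normalizedSphereMeasure, integral_smul_measure, hemb.integral_map]

theorem twistedGaussian_eq_zero_of_twistedSphericalMean (hG : IsHTypeLieAlgebra ip)
    {f : EuclideanSpace ℂ (Fin n) → ℂ} {a c : ℝ} (hlam : ‖lam‖ / 4 < a)
    (hf : AEStronglyMeasurable f volume)
    (hint : Integrable (fun z => ‖f z‖ * Real.exp (a * ‖z‖ ^ 2)) volume)
    (hc : -(‖lam‖ / 4) ≤ c) {z : EuclideanSpace ℂ (Fin n)}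
    (hmean : ∀ᵐ s : ℝ, 0 < s → F.twistedSphericalMean lam f s z = 0) :
    twistedGaussian volume (F.phaseMap lam) f c z = 0 := by
  have : NeZero n := ⟨F.index_ne_zero hG⟩
  set g : EuclideanSpace ℂ (Fin n) → ℂ := fun w => f w * Complex.exp (-(c * ‖z - w‖ ^ 2 : ℝ) +
    (inner ℝ (F.phaseMap lam z) w / 2 : ℝ) * Complex.I) with hg
  have hgi : Integrable g volume := by
    have := integrable_twistedGaussian_kernel_mul_exp (A := F.phaseMap lam) hf hint
      (norm_nonneg lam) hc z (g := fun _ => 0) (b := 0) (C := 0) (r := ‖z‖) continuous_const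
      (by linarith) le_rfl (by simp)
    exact (integrable_norm_iff
      (aestronglyMeasurable_twistedGaussian_kernel hf c z)).1 (by simpa using this)
  have h0 := integral_eq_zero_of_sphere_integrals volume
    (hgi.comp_sub_left z) (by
      filter_upwards [hmean] with s hs hs0
      have h1 := hs hs0
      rw [F.twistedSphericalMean_eq lam f hs0, smul_eq_zero] at h1
      have h2 : (((volume : Measure (EuclideanSpace ℂ (Fin n))).toSphere
          Set.univ)⁻¹).toReal ≠ 0 := by
        refine ENNReal.toReal_ne_zero.2 ⟨ENNReal.inv_ne_zero.2 (measure_ne_top _ _),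
          ENNReal.inv_ne_top.2 ?_⟩
        rw [Measure.measure_univ_ne_zero]
        exact Measure.toSphere_ne_zero _
      -- On the sphere of radius s about z the Gaussian is the constant e^{-cs²}, and ⟨Az,z⟩ = 0
      -- with skewness makes the two phases agree.
      rw [← mul_zero (Complex.exp (-(c * s ^ 2 : ℝ))), ← h1.resolve_left h2,
        ← integral_const_mul]
      refine integral_congr_ae (.of_forall fun ω => ?_)
      simp only [hg]
      have h3 : inner ℝ (F.phaseMap lam z) (z - s • (ω : EuclideanSpace ℂ (Fin n)))
          = F.phase lam z (s • (ω : EuclideanSpace ℂ (Fin n))) := by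
        rw [phase_eq_inner, inner_sub_right, F.inner_phaseMap_self lam hG,
          F.inner_phaseMap_left lam hG]
        ring
      have h4 : ‖z - (z - s • (ω : EuclideanSpace ℂ (Fin n)))‖ = s := by
        rw [sub_sub_cancel, norm_smul]
        simp [hs0.le]
      rw [h3, h4, mul_left_comm, ← Complex.exp_add]
      congr 2
      push_cast; ring)
  rw [integral_sub_left_eq_self g volume z] at h0
  exact h0

end AdaptedFrame

theorem mainTheorem7 {𝔤 : Type*} [LieRing 𝔤] [LieAlgebra ℝ 𝔤]
    (ip : LinearMap.BilinForm ℝ 𝔤) (hG : IsHTypeLieAlgebra ip)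
    {n m : ℕ} (F : AdaptedFrame ip n m)
    (lam : EuclideanSpace ℝ (Fin m)) (hlam : lam ≠ 0)
    (Ω : Set (EuclideanSpace ℂ (Fin n)))
    (hΩ_open : IsOpen Ω) (hΩ_conn : IsConnected Ω) (hΩ_bdd : Bornology.IsBounded Ω)
    (f : EuclideanSpace ℂ (Fin n) → ℂ)
    (ε : ℝ) (hε : 0 < ε) (p : ENNReal) (hp : 1 ≤ p)
    (hf : MemLp (fun z => f z * ((Real.exp ((1 / 4 + ε) * ‖lam‖ * ‖z‖ ^ 2) : ℝ) : ℂ)) p volume)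
    (hmean : ∀ z ∈ frontier Ω, ∀ᵐ s : ℝ, 0 < s → F.twistedSphericalMean lam f s z = 0) :
    f =ᵐ[volume] 0 := by
  have hL : 0 < ‖lam‖ := norm_pos_iff.2 hlam
  -- Half of ε is spent on passing to L¹; the other half keeps the rate above |λ|/4.
  obtain ⟨hfm, hint⟩ := hf.integrable_norm_mul_exp_sq (a := (1 / 4 + ε / 2) * ‖lam‖)
    (by nlinarith) hp
  have ha : ‖lam‖ / 4 < (1 / 4 + ε / 2) * ‖lam‖ := by nlinarith
  exact ae_eq_zero_of_twistedGaussian_frontier hfm hint hL ha (F.inner_phaseMap_left lam hG)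
    (F.phaseMap_phaseMap lam hG) (F.index_ne_zero hG)
    (by rw [← Module.finrank_mul_finrank ℝ ℂ]; simp) hΩ_open hΩ_conn.nonempty hΩ_bdd
    fun z hz c hc => F.twistedGaussian_eq_zero_of_twistedSphericalMean lam hG ha hfm hint hc.1
      (hmean z hz)
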